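/- Let $K$ be a field. A $K$-algebra is a $K$-vector space $A$ with a bilinear product $\circ$ (not assumed associative or unital). It is called (right) Novikov if $$a\circ(b\circ c)-(a\circ b)\circ c=a\circ(c\circ b)-(a\circ c)\circ b\quad\text{and}\quad a\circ(b\circ c)=b\circ(a\circ c)$$ for all $a,b,c\in A$. Let $A^+$ be the vector space $A$ with the commutative product $\{a,b\}=a\circ b+b\circ a$. An algebra $(B,\star)$ is called Tortken if $$(a\star b)\star(c\star d)-(a\star d)\star(c\star b)=(a,b,c)\star d-(a,d,c)\star b$$ for all $a,b,c,d\in B$, where $(a,b,c)=a\star(b\star c)-(a\star b)\star c$. Non-associative polynomials are the elements of the free non-associative $K$-algebra without unit on variables $t_0,t_1,t_2,\dots$; such a polynomial is an identity on an algebra if it vanishes under all substitutions of elements of the algebra for the variables. A polynomial follows from a set $S$ of polynomials if it lies in the smallest two-sided ideal of the free algebra that contains all substitution instances of the elements of $S$. Commutativity is the polynomial $t_0t_1-t_1t_0$, and the Tortken polynomial is $$(t_0t_1)(t_2t_3)-(t_0t_3)(t_2t_1)-\bigl(t_0(t_1t_2)-(t_0t_1)t_2\bigr)t_3+\bigl(t_0(t_3t_2)-(t_0t_3)t_2\bigr)t_1.$$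 **Theorem.** (1) If $A$ is a Novikov algebra over a field $K$ of any characteristic, then $A^+$ is a Tortken algebra. (2) If $\operatorname{char}K\neq 2$, then the Tortken identity is the Jordan identity of the class of Novikov algebras over $K$, that is, it is the identity of minimal degree of the algebras $A^+$ ($A$ Novikov) that does not follow from commutativity. Precisely: - (a) the Tortken polynomial does not follow from commutativity; - (b) a polynomial of degree at most $3$ is an identity on $A^+$ for every Novikov $K$-algebra $A$ if and only if it follows from commutativity; - (c) a multilinear polynomial of degree $4$ in $t_0,t_1,t_2,t_3$ is an identity on $A^+$ for every Novikov $K$-algebra $A$ if and only if it follows from commutativity and the Tortken polynomial. -/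

import Mathlib

open FreeNonUnitalNonAssocAlgebra

universe u v

/-- The (right) Novikov identities for a bilinear product `a ∘ b = a * b`:
right-symmetry `(a, b, c) = (a, c, b)`, where `(a, b, c) = a ∘ (b ∘ c) - (a ∘ b) ∘ c`,
and left-commutativity `a ∘ (b ∘ c) = b ∘ (a ∘ c)`. -/
structure IsNovikov (A : Type v) [NonUnitalNonAssocRing A] : Prop where
  right_symm : ∀ a b c : A,
    a * (b * c) - (a * b) * c = a * (c * b) - (a * c) * b
  left_comm : ∀ a b c : A, a * (b * c) = b * (a * c)

/-- The (right) Tortken identity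
`(ab)(cd) - (ad)(cb) = (a,b,c)d - (a,d,c)b`, where `(a,b,c) = a(bc) - (ab)c`. -/
def IsTortken (A : Type v) [NonUnitalNonAssocRing A] : Prop :=
  ∀ a b c d : A,
    (a * b) * (c * d) - (a * d) * (c * b) =
      (a * (b * c) - (a * b) * c) * d - (a * (d * c) - (a * d) * c) * b

/-- The underlying vector space of the Jordan algebra `A⁺` of `A`. -/
def PlusAlg (A : Type v) : Type v := A

namespace PlusAlg

variable {A : Type v}

/-- The identity map `A → A⁺`. -/
def mk : A → PlusAlg A := fun a => a

/-- The identity map `A⁺ → A`. -/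
def val : PlusAlg A → A := fun a => a

instance [NonUnitalNonAssocRing A] : AddCommGroup (PlusAlg A) :=
  inferInstanceAs (AddCommGroup A)

/-- The Jordan product `{a, b} = a ∘ b + b ∘ a` on `A⁺`. -/
instance [NonUnitalNonAssocRing A] : Mul (PlusAlg A) :=
  ⟨fun a b => mk (a.val * b.val + b.val * a.val)⟩

theorem mul_def [NonUnitalNonAssocRing A] (a b : A) : mk a * mk b = mk (a * b + b * a) := rfl

instance [NonUnitalNonAssocRing A] : NonUnitalNonAssocRing (PlusAlg A) :=
  { (inferInstance : AddCommGroup (PlusAlg A)), (inferInstance : Mul (PlusAlg A)) with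
    left_distrib := fun (a b c : A) => by
      change a * (b + c) + (b + c) * a = (a * b + b * a) + (a * c + c * a)
      rw [mul_add, add_mul]; abel
    right_distrib := fun (a b c : A) => by
      change (a + b) * c + c * (a + b) = (a * c + c * a) + (b * c + c * b)
      rw [mul_add, add_mul]; abel
    zero_mul := fun (a : A) => by
      change (0 : A) * a + a * 0 = 0
      simp
    mul_zero := fun (a : A) => by
      change a * (0 : A) + 0 * a = 0
      simp }

variable {K : Type u} [Field K] [NonUnitalNonAssocRing A] [Module K A]

instance : Module K (PlusAlg A) := inferInstanceAs (Module K A)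

instance [IsScalarTower K A A] [SMulCommClass K A A] :
    IsScalarTower K (PlusAlg A) (PlusAlg A) :=
  ⟨fun (r : K) (a b : A) => by
    change (r • a) * b + b * (r • a) = r • (a * b + b * a)
    rw [smul_mul_assoc, mul_smul_comm, smul_add]⟩

instance [IsScalarTower K A A] [SMulCommClass K A A] :
    SMulCommClass K (PlusAlg A) (PlusAlg A) :=
  ⟨fun (r : K) (a b : A) => by
    change r • (a * b + b * a) = a * (r • b) + (r • b) * a
    rw [smul_mul_assoc, mul_smul_comm, smul_add]⟩

end PlusAlg

section Identities

variable (K : Type u) [Field K]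

/-- Non-associative polynomials over `K` (without constant term) in the variables
`t_0, t_1, t_2, …`: linear combinations of nonempty bracketed words. -/
abbrev NAPoly : Type u := FreeNonUnitalNonAssocAlgebra K ℕ

/-- The polynomial `f` is an identity on the `K`-algebra `A`: it vanishes under every
substitution `t_i := a i` of elements of `A`. -/
def IsIdentityOn (f : NAPoly K) (A : Type v) [NonUnitalNonAssocRing A] [Module K A]
    [IsScalarTower K A A] [SMulCommClass K A A] : Prop :=
  ∀ a : ℕ → A, lift K a f = 0

/-- `f` is an identity of the class `𝒩⁺`: it is an identity on `A⁺` for every Novikov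
algebra `A` over `K`. -/
def IsNovikovJordanIdentity (f : NAPoly K) : Prop :=
  ∀ (A : Type u) [NonUnitalNonAssocRing A] [Module K A] [IsScalarTower K A A]
    [SMulCommClass K A A], IsNovikov A → IsIdentityOn K f (PlusAlg A)

/-- `f` follows from the identities `S`: it lies in the T-ideal generated by `S`, the smallest
two-sided ideal of the free non-associative algebra that contains all substitution instances
of the elements of `S`. -/
inductive FollowsFrom (S : Set (NAPoly K)) : NAPoly K → Prop
  | subst (g : NAPoly K) (hg : g ∈ S) (a : ℕ → NAPoly K) : FollowsFrom S (lift K a g)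
  | zero : FollowsFrom S 0
  | add (f g : NAPoly K) : FollowsFrom S f → FollowsFrom S g → FollowsFrom S (f + g)
  | smul (r : K) (f : NAPoly K) : FollowsFrom S f → FollowsFrom S (r • f)
  | mul_left (h f : NAPoly K) : FollowsFrom S f → FollowsFrom S (h * f)
  | mul_right (h f : NAPoly K) : FollowsFrom S f → FollowsFrom S (f * h)

/-- The commutativity polynomial `t_0 t_1 - t_1 t_0`. -/
noncomputable def comPoly : NAPoly K := of K 0 * of K 1 - of K 1 * of K 0

/-- The Tortken polynomial
`(ab)(cd) - (ad)(cb) - (a(bc) - (ab)c)d + (a(dc) - (ad)c)b`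
in `a = t_0`, `b = t_1`, `c = t_2`, `d = t_3`. -/
noncomputable def tortkenPoly : NAPoly K :=
  (of K 0 * of K 1) * (of K 2 * of K 3) - (of K 0 * of K 3) * (of K 2 * of K 1)
    - (of K 0 * (of K 1 * of K 2) - (of K 0 * of K 1) * of K 2) * of K 3
    + (of K 0 * (of K 3 * of K 2) - (of K 0 * of K 3) * of K 2) * of K 1

/-- The multiset of (indices of) variables that occur in a bracketed word. -/
def letters : FreeMagma ℕ → Multiset ℕ
  | .of i => {i}
  | .mul x y => letters x + letters y

variable {K}

/-- `f` has degree at most `n`. -/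
def DegreeLE (n : ℕ) (f : NAPoly K) : Prop :=
  ∀ w ∈ f.coeff.support, w.length ≤ n

/-- `f` is multilinear of degree `n`: every one of its monomials contains each of
`t_0, …, t_{n-1}` exactly once and no other variable. -/
def IsMultilinearPoly (n : ℕ) (f : NAPoly K) : Prop :=
  ∀ w ∈ f.coeff.support, letters w = Multiset.range n

/-- The Tortken polynomial is an identity on `A` exactly if `A` is a Tortken algebra. -/
theorem isIdentityOn_tortkenPoly_iff (A : Type v) [NonUnitalNonAssocRing A] [Module K A]
    [IsScalarTower K A A] [SMulCommClass K A A] :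
    IsIdentityOn K (tortkenPoly K) A ↔ IsTortken A := by
  have key : ∀ a : ℕ → A, lift K a (tortkenPoly K) =
      (a 0 * a 1) * (a 2 * a 3) - (a 0 * a 3) * (a 2 * a 1)
        - (a 0 * (a 1 * a 2) - (a 0 * a 1) * a 2) * a 3
        + (a 0 * (a 3 * a 2) - (a 0 * a 3) * a 2) * a 1 := by
    intro a
    simp only [tortkenPoly, map_add, map_sub, map_mul, lift_of_apply]
  constructor
  · intro h a b c d
    have := h (fun n => match n with | 0 => a | 1 => b | 2 => c | _ => d)
    rw [key] at this
    rw [← sub_eq_zero, ← this]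
    abel
  · intro h a
    rw [key]
    have := sub_eq_zero.mpr (h (a 0) (a 1) (a 2) (a 3))
    rw [← this]
    abel

end Identities


/-!
For `A` Novikov and `e = c ∘ a - a ∘ c`, the associator of `A⁺` is `(a, b, c) = {b, e}`. Applying
this twice turns the right-hand side of the Tortken identity into the product of two commutators
`{c ∘ a - a ∘ c, b ∘ d - d ∘ b}`, and the left-hand side has the same value.

Conversely, let `A` be the algebra of differential polynomials with `a ∘ b = a' b`, so that
`{a, b} = (a b)'`. If `B` is a commutative algebra which is Tortken, a linear map from `A` to `B`
carries the value in `A⁺` of each word `w` of length at most `4` to `8 w`. An identity of degree at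
most `4` of all algebras `A⁺` therefore holds in `B` if `char K ≠ 2`, in particular in the
relatively free algebra. The Tortken identity of `B` is only needed for words of length `4`.
-/

section Novikov

variable {A : Type v} [NonUnitalNonAssocRing A]

theorem IsNovikov.mul_mul_add_mul_mul_swap (hA : IsNovikov A) (a b c d : A) :
    (a * b) * (c * d) + (c * d) * (a * b) = (a * d) * (c * b) + (c * b) * (a * d) := by
  have mul_right_symm (x y z w : A) :
      x * ((y * z) * w) - x * ((y * w) * z) = x * (y * (z * w)) - x * (y * (w * z)) := by
    rw [← mul_sub, ← mul_sub]
    congr 1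
    linear_combination (norm := module) -hA.right_symm y z w
  rw [hA.left_comm (a * b), hA.left_comm (c * d), hA.left_comm (a * d), hA.left_comm (c * b)]
  linear_combination (norm := module) mul_right_symm c a b d + mul_right_symm a c d b
    + hA.left_comm c a (b * d) - hA.left_comm c a (d * b)

namespace PlusAlg

instance : NonUnitalNonAssocCommRing (PlusAlg A) :=
  { (inferInstance : NonUnitalNonAssocRing (PlusAlg A)) with
    mul_comm := fun a b => add_comm (a.val * b.val) (b.val * a.val) }

theorem mk_sub (a b : A) : mk a - mk b = mk (a - b) := rfl

theorem associator_eq (hA : IsNovikov A) (a b c : A) :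
    mk a * (mk b * mk c) - (mk a * mk b) * mk c = mk b * mk (c * a - a * c) := by
  simp only [mul_def, mk_sub]
  congr 1
  simp only [mul_add, add_mul, mul_sub, sub_mul]
  linear_combination (norm := module) hA.right_symm a b c + hA.right_symm b a c
    + hA.right_symm c a b + 2 • hA.left_comm a c b

theorem mul_mul_sub_mul_mul (hA : IsNovikov A) (a b c d : A) :
    (mk a * mk b) * (mk c * mk d) - (mk a * mk d) * (mk c * mk b) =
      mk (c * a - a * c) * mk (b * d - d * b) := by
  have swap := hA.mul_mul_add_mul_mul_swap
  simp only [mul_def, mk_sub]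
  congr 1
  simp only [mul_add, add_mul, mul_sub, sub_mul]
  linear_combination (norm := module) swap a b c d + swap a b d c + swap b a c d
    + swap b a d c - swap d a c b - swap a d b c

theorem isTortken (hA : IsNovikov A) : IsTortken (PlusAlg A) := by
  intro (a : A) (b : A) (c : A) (d : A)
  change (mk a * mk b) * (mk c * mk d) - (mk a * mk d) * (mk c * mk b) =
    (mk a * (mk b * mk c) - (mk a * mk b) * mk c) * mk d
      - (mk a * (mk d * mk c) - (mk a * mk d) * mk c) * mk b
  rw [mul_mul_sub_mul_mul hA, associator_eq hA, associator_eq hA, mul_comm _ (mk d),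
    mul_comm (mk b), associator_eq hA]

theorem not_isTortken_matrix (R : Type*) [Ring R] [Nontrivial R] :
    ¬ IsTortken (PlusAlg (Matrix (Fin 3) (Fin 3) R)) := by
  intro h
  have tortken := h (mk (Matrix.single 0 0 1)) (mk (Matrix.single 0 1 1))
    (mk (Matrix.single 1 1 1)) (mk (Matrix.single 1 2 1))
  simp only [mul_def, mk_sub] at tortken
  have entry := congrFun (congrFun (congrArg val tortken) 0) 2
  simp [mk, val] at entry

end PlusAlg

end Novikov

section Consequences

variable {K : Type u} [Field K]

theorem isIdentityOn_comPoly_iff (A : Type v) [NonUnitalNonAssocRing A] [Module K A]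
    [IsScalarTower K A A] [SMulCommClass K A A] :
    IsIdentityOn K (comPoly K) A ↔ ∀ a b : A, a * b = b * a := by
  have lift_comPoly (a : ℕ → A) : lift K a (comPoly K) = a 0 * a 1 - a 1 * a 0 := by
    simp only [comPoly, map_sub, map_mul, lift_of_apply]
  constructor
  · intro h a b
    simpa [lift_comPoly, sub_eq_zero] using h (fun n => if n = 0 then a else b)
  · intro h a
    rw [lift_comPoly, h, sub_self]

theorem map_lift {R X A B : Type*} [CommSemiring R]
    [NonUnitalNonAssocSemiring A] [Module R A] [IsScalarTower R A A] [SMulCommClass R A A]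
    [NonUnitalNonAssocSemiring B] [Module R B] [IsScalarTower R B B] [SMulCommClass R B B]
    (φ : A →ₙₐ[R] B) (s : X → A) (f : FreeNonUnitalNonAssocAlgebra R X) :
    φ (lift R s f) = lift R (φ ∘ s) f := by
  have : φ.comp (lift R s) = lift R (φ ∘ s) := hom_ext R fun i => by
    simp only [NonUnitalAlgHom.comp_apply, lift_of_apply, Function.comp_apply]
  exact DFunLike.congr_fun this f

variable {S : Set (NAPoly K)} {f : NAPoly K}

namespace FollowsFrom

theorem isIdentityOn (hf : FollowsFrom K S f) {A : Type v} [NonUnitalNonAssocRing A] [Module K A]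
    [IsScalarTower K A A] [SMulCommClass K A A] (hS : ∀ g ∈ S, IsIdentityOn K g A) :
    IsIdentityOn K f A := by
  intro a
  induction hf with
  | subst g hg s => rw [map_lift]; exact hS g hg _
  | zero => exact map_zero _
  | add f g _ _ hf hg => rw [map_add, hf, hg, add_zero]
  | smul r f _ hf => rw [map_smul, hf, smul_zero]
  | mul_left h f _ hf => rw [map_mul, hf, mul_zero]
  | mul_right h f _ hf => rw [map_mul, hf, zero_mul]

theorem neg (hf : FollowsFrom K S f) : FollowsFrom K S (-f) := by
  simpa using hf.smul (-1)

end FollowsFrom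

variable (S) in
/-- The congruence on non-associative polynomials given by equality modulo the consequences of
`S`. -/
def identityCon : RingCon (NAPoly K) where
  r f g := FollowsFrom K S (f - g)
  iseqv :=
    { refl := fun f => by rw [sub_self]; exact .zero
      symm := fun h => by simpa using h.neg
      trans := fun h h' => by simpa using h.add _ _ h' }
  add' h h' := by simpa [add_sub_add_comm] using h.add _ _ h'
  mul' {w x y z} h h' := by
    simpa [sub_mul, mul_sub] using (h.mul_right y _).add _ _ (h'.mul_left x _)

variable (S) in
/-- The relatively free algebra, on countably many generators, of the class of algebras defined by
the identities `S`. -/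
abbrev RelFree : Type u := (identityCon S).Quotient

namespace RelFree

noncomputable instance : SMul K (RelFree S) :=
  ⟨(identityCon S).smulAux fun r f g (h : FollowsFrom K S (f - g)) => by
    change FollowsFrom K S (r • f - r • g)
    rw [← smul_sub]
    exact h.smul r _⟩

noncomputable instance : Module K (RelFree S) :=
  Function.Surjective.module K ⟨⟨((↑) : NAPoly K → RelFree S), rfl⟩, fun _ _ => rfl⟩
    Quotient.mk_surjective fun _ _ => rfl

instance : IsScalarTower K (RelFree S) (RelFree S) where
  smul_assoc r x y := by
    induction x, y using Quotient.inductionOn₂ with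
    | h f g => exact congrArg ((↑) : NAPoly K → RelFree S) (smul_mul_assoc r f g)

instance : SMulCommClass K (RelFree S) (RelFree S) where
  smul_comm r x y := by
    induction x, y using Quotient.inductionOn₂ with
    | h f g => exact congrArg ((↑) : NAPoly K → RelFree S) (mul_smul_comm r f g).symm

variable (S) in
/-- The quotient map from the free algebra to the relatively free algebra. -/
noncomputable def mk : NAPoly K →ₙₐ[K] RelFree S where
  toFun f := f
  map_smul' _ _ := rfl
  map_zero' := rfl
  map_add' _ _ := rfl
  map_mul' _ _ := rfl

theorem mk_surjective : Function.Surjective (mk S) := Quotient.mk_surjective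

theorem mk_eq_zero : mk S f = 0 ↔ FollowsFrom K S f := by
  rw [← map_zero (mk S)]
  refine (RingCon.eq _).trans ?_
  change FollowsFrom K S (f - 0) ↔ _
  rw [sub_zero]

theorem isIdentityOn (hf : f ∈ S) : IsIdentityOn K f (RelFree S) := by
  intro a
  obtain ⟨s, rfl⟩ := mk_surjective.comp_left a
  rw [← map_lift, mk_eq_zero]
  exact .subst f hf s

end RelFree

theorem followsFrom_iff_forall_isIdentityOn :
    FollowsFrom K S f ↔ ∀ (B : Type u) [NonUnitalNonAssocRing B] [Module K B]
      [IsScalarTower K B B] [SMulCommClass K B B],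
      (∀ g ∈ S, IsIdentityOn K g B) → IsIdentityOn K f B := by
  refine ⟨fun h B _ _ _ _ hB => h.isIdentityOn hB, fun h => ?_⟩
  have lift_of : lift K (of K) f = f := by
    rw [← Function.id_comp (of K), ← NonUnitalAlgHom.coe_id (R := K), lift_comp_of]
    rfl
  rw [← RelFree.mk_eq_zero, ← lift_of, map_lift]
  exact h (RelFree S) (fun g hg => RelFree.isIdentityOn hg) _

theorem followsFrom_iff_of_comPoly_mem (hS : comPoly K ∈ S) :
    FollowsFrom K S f ↔ ∀ (B : Type u) [NonUnitalNonAssocCommRing B] [Module K B]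
      [IsScalarTower K B B] [SMulCommClass K B B],
      (∀ g ∈ S, IsIdentityOn K g B) → IsIdentityOn K f B := by
  refine ⟨fun h B _ _ _ _ hB => h.isIdentityOn hB, fun h => ?_⟩
  refine followsFrom_iff_forall_isIdentityOn.2 fun B _ _ _ _ hB => ?_
  let : NonUnitalNonAssocCommRing B :=
    { ‹NonUnitalNonAssocRing B› with
      mul_comm := (isIdentityOn_comPoly_iff B).1 (hB _ hS) }
  exact h B hB

theorem not_followsFrom_comPoly_tortkenPoly : ¬ FollowsFrom K {comPoly K} (tortkenPoly K) := by
  intro h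
  refine PlusAlg.not_isTortken_matrix K ((isIdentityOn_tortkenPoly_iff (K := K) _).1
    (h.isIdentityOn ?_))
  rintro g rfl
  exact (isIdentityOn_comPoly_iff _).2 mul_comm

theorem FollowsFrom.isNovikovJordanIdentity (hf : FollowsFrom K S f)
    (hS : S ⊆ {comPoly K, tortkenPoly K}) : IsNovikovJordanIdentity K f := by
  intro A _ _ _ _ hA
  refine hf.isIdentityOn fun g hg => ?_
  obtain rfl | rfl := hS hg
  · exact (isIdentityOn_comPoly_iff _).2 mul_comm
  · exact (isIdentityOn_tortkenPoly_iff _).2 (PlusAlg.isTortken hA)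

end Consequences

section Words

variable {α M : Type*} [CommMagma M] (x : α → M) {w : FreeMagma α}

theorem exists_lift_eq_of_length_eq_one (hw : w.length = 1) :
    ∃ i, FreeMagma.lift x w = x i := by
  cases w with
  | of i => exact ⟨i, FreeMagma.lift_of x i⟩
  | mul u v =>
    have := u.length_pos
    have := v.length_pos
    simp only [FreeMagma.length] at hw
    omega

theorem exists_lift_eq_of_length_eq_two (hw : w.length = 2) :
    ∃ i j, FreeMagma.lift x w = x i * x j := by
  cases w with
  | of i => simp [FreeMagma.length] at hw
  | mul u v =>
    have := u.length_pos
    have := v.length_pos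
    simp only [FreeMagma.length] at hw
    obtain ⟨i, hi⟩ := exists_lift_eq_of_length_eq_one x (w := u) (by omega)
    obtain ⟨j, hj⟩ := exists_lift_eq_of_length_eq_one x (w := v) (by omega)
    exact ⟨i, j, by rw [FreeMagma.mul_eq, map_mul, hi, hj]⟩

theorem exists_lift_eq_of_length_eq_three (hw : w.length = 3) :
    ∃ i j k, FreeMagma.lift x w = x i * (x j * x k) := by
  cases w with
  | of i => simp [FreeMagma.length] at hw
  | mul u v =>
    have := u.length_pos
    have := v.length_pos
    simp only [FreeMagma.length] at hw
    simp only [FreeMagma.mul_eq, map_mul]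
    wlog h : u.length = 1 generalizing u v
    · simpa only [mul_comm] using this v u (by omega) (by omega) (by omega) (by omega)
    obtain ⟨i, hi⟩ := exists_lift_eq_of_length_eq_one x h
    obtain ⟨j, k, hjk⟩ := exists_lift_eq_of_length_eq_two x (w := v) (by omega)
    exact ⟨i, j, k, by rw [hi, hjk]⟩

theorem exists_lift_eq_of_length_eq_four (hw : w.length = 4) :
    ∃ i j k l, FreeMagma.lift x w = x i * (x j * (x k * x l)) ∨
      FreeMagma.lift x w = (x i * x j) * (x k * x l) := by
  cases w with
  | of i => simp [FreeMagma.length] at hw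
  | mul u v =>
    have := u.length_pos
    have := v.length_pos
    simp only [FreeMagma.length] at hw
    simp only [FreeMagma.mul_eq, map_mul]
    wlog h : u.length ≤ 2 generalizing u v
    · simpa only [mul_comm] using this v u (by omega) (by omega) (by omega) (by omega)
    obtain h | h : u.length = 1 ∨ u.length = 2 := by omega
    · obtain ⟨i, hi⟩ := exists_lift_eq_of_length_eq_one x h
      obtain ⟨j, k, l, hjkl⟩ := exists_lift_eq_of_length_eq_three x (w := v) (by omega)
      exact ⟨i, j, k, l, .inl (by rw [hi, hjkl])⟩
    · obtain ⟨i, j, hij⟩ := exists_lift_eq_of_length_eq_two x h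
      obtain ⟨k, l, hkl⟩ := exists_lift_eq_of_length_eq_two x (w := v) (by omega)
      exact ⟨i, j, k, l, .inr (by rw [hij, hkl])⟩

theorem lift_prodMk {α M N : Type*} [Mul M] [Mul N] (x : α → M) (y : α → N) (w : FreeMagma α) :
    FreeMagma.lift (fun i => (x i, y i)) w = (FreeMagma.lift x w, FreeMagma.lift y w) := by
  have : FreeMagma.lift (fun i => (x i, y i)) = (FreeMagma.lift x).prod (FreeMagma.lift y) :=
    FreeMagma.hom_ext (funext fun i => by simp)
  rw [this, MulHom.prod_apply]

end Words

section WordExpansion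

variable {R X : Type*} [CommSemiring R]
  {A : Type*} [NonUnitalNonAssocSemiring A] [Module R A] [IsScalarTower R A A] [SMulCommClass R A A]
  {B : Type*} [NonUnitalNonAssocSemiring B] [Module R B] [IsScalarTower R B B] [SMulCommClass R B B]

theorem lift_apply_eq_sum (a : X → A) (f : FreeNonUnitalNonAssocAlgebra R X) :
    lift R a f = ∑ w ∈ f.coeff.support, f.coeff w • FreeMagma.lift a w := by
  simp [lift, MonoidAlgebra.liftMagma_apply_apply, Finsupp.sum]

theorem map_lift_eq_smul_lift (ρ : A →ₗ[R] B) (a : X → A) (b : X → B) (c : R)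
    {f : FreeNonUnitalNonAssocAlgebra R X}
    (hρ : ∀ w ∈ f.coeff.support, ρ (FreeMagma.lift a w) = c • FreeMagma.lift b w) :
    ρ (lift R a f) = c • lift R b f := by
  simp only [lift_apply_eq_sum, map_sum, map_smul, Finset.smul_sum]
  exact Finset.sum_congr rfl fun w hw => by rw [hρ w hw, smul_comm]

end WordExpansion

/-- The Novikov algebra of a commutative algebra `R` with a derivation `D`, due to Gelfand and
Dorfman: the vector space `R` with the product `a ∘ b = D a * b`. -/
def GelfandDorfman {k : Type u} {R : Type v} [CommRing k] [CommRing R] [Algebra k R]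
    (_D : Derivation k R R) : Type v := R

namespace GelfandDorfman

section CommRing

variable {k : Type u} {R : Type v} [CommRing k] [CommRing R] [Algebra k R] (D : Derivation k R R)

instance : AddCommGroup (GelfandDorfman D) := inferInstanceAs (AddCommGroup R)

instance : Module k (GelfandDorfman D) := inferInstanceAs (Module k R)

instance : Mul (GelfandDorfman D) := ⟨fun (a b : R) => (D a * b : R)⟩

instance : NonUnitalNonAssocRing (GelfandDorfman D) :=
  { (inferInstance : AddCommGroup (GelfandDorfman D)),
    (inferInstance : Mul (GelfandDorfman D)) with
    left_distrib := fun (a b c : R) => mul_add (D a) b c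
    right_distrib := fun (a b c : R) => by
      change D (a + b) * c = D a * c + D b * c
      rw [map_add, add_mul]
    zero_mul := fun (a : R) => by
      change D 0 * a = 0
      rw [map_zero, zero_mul]
    mul_zero := fun (a : R) => mul_zero (D a) }

instance : IsScalarTower k (GelfandDorfman D) (GelfandDorfman D) :=
  ⟨fun (r : k) (a b : R) => by
    change D (r • a) * b = r • (D a * b)
    rw [D.map_smul, smul_mul_assoc]⟩

instance : SMulCommClass k (GelfandDorfman D) (GelfandDorfman D) :=
  ⟨fun (r : k) (a b : R) => (mul_smul_comm r (D a) b).symm⟩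

theorem isNovikov : IsNovikov (GelfandDorfman D) where
  right_symm := fun (a : R) (b : R) (c : R) => by
    change D a * (D b * c) - D (D a * b) * c = D a * (D c * b) - D (D a * c) * b
    simp only [Derivation.leibniz, smul_eq_mul]
    ring
  left_comm := fun (a : R) (b : R) (c : R) => mul_left_comm (D a) (D b) c

end CommRing

section Field

variable {K : Type u} {R : Type v} [Field K] [CommRing R] [Algebra K R] (D : Derivation K R R)

/-- The identity map from `R` to `A⁺`, where `A` is the Gelfand–Dorfman algebra of `R`. -/
def toPlus : R ≃ₗ[K] PlusAlg (GelfandDorfman D) := LinearEquiv.refl K R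

theorem toPlus_mul_toPlus (f g : R) : toPlus D f * toPlus D g = toPlus D (D (f * g)) := by
  change D f * g + D g * f = D (f * g)
  rw [Derivation.leibniz, smul_eq_mul, smul_eq_mul, mul_comm (D g), mul_comm g, add_comm]

end Field

end GelfandDorfman

section SymmetricFunctions

variable {α β : Type*}

theorem eq_of_pair_eq {F : α → α → β} (h : ∀ q r, F q r = F r q) {q r q' r' : α}
    (e : ({q, r} : Multiset α) = {q', r'}) : F q r = F q' r' := by
  have hq : q ∈ ({q', r'} : Multiset α) := e ▸ Multiset.mem_cons_self q _
  simp only [Multiset.insert_eq_cons, Multiset.mem_cons, Multiset.mem_singleton] at hq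
  rcases hq with rfl | rfl
  · rw [Multiset.singleton_inj.1 ((Multiset.cons_inj_right q).1 e)]
  · rw [Multiset.pair_comm q' q] at e
    rw [Multiset.singleton_inj.1 ((Multiset.cons_inj_right q).1 e), h]

theorem eq_of_triple_eq {F : α → α → α → β} (h₁ : ∀ q r s, F q r s = F r q s)
    (h₂ : ∀ q r s, F q r s = F q s r) {q r s q' r' s' : α}
    (e : ({q, r, s} : Multiset α) = {q', r', s'}) : F q r s = F q' r' s' := by
  have hq : q ∈ ({q', r', s'} : Multiset α) := e ▸ Multiset.mem_cons_self q _
  simp only [Multiset.insert_eq_cons, Multiset.mem_cons, Multiset.mem_singleton] at hq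
  rcases hq with rfl | rfl | rfl
  · exact eq_of_pair_eq (h₂ q) ((Multiset.cons_inj_right q).1 e)
  · rw [h₁ q' q]
    refine eq_of_pair_eq (h₂ q) ((Multiset.cons_inj_right q).1 (e.trans ?_))
    exact Multiset.cons_swap q' q _
  · rw [h₂ q' r', h₁ q' q]
    refine eq_of_pair_eq (h₂ q) ((Multiset.cons_inj_right q).1 (e.trans ?_))
    exact (congrArg (q' ::ₘ ·) (Multiset.pair_comm r' q)).trans (Multiset.cons_swap q' q _)

end SymmetricFunctions

section TortkenElements

variable {B : Type v} [NonUnitalNonAssocCommRing B]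

/-- The element of a commutative algebra that corresponds to the differential monomial
`2 p'' q r`, where the product of the algebra corresponds to `(p q)'`. -/
def cubic₂ (p q r : B) : B := q * (p * r) + r * (p * q) - p * (q * r)

/-- The element of a commutative Tortken algebra that corresponds to `4 (p' q' r s)'` and to
`8 p'' q' r s`, where the product of the algebra corresponds to `(p q)'`. -/
def quartic₁₁ (p q r s : B) : B :=
  (p * r) * (q * s) + (p * s) * (q * r) - (p * q) * (r * s)
    + r * (p * (q * s)) - p * (r * (q * s)) + s * (q * (p * r)) - q * (s * (p * r))

/-- The element of a commutative Tortken algebra that corresponds to `4 (p'' q r s)'`, where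
the product of the algebra corresponds to `(p q)'`. -/
def quartic₂ (p q r s : B) : B := 2 • (s * cubic₂ p q r) - quartic₁₁ p q r s - quartic₁₁ p r q s

/-- The element of a commutative Tortken algebra that corresponds to the differential monomial
`8 p''' q r s`, where the product of the algebra corresponds to `(p q)'`. -/
def quartic₃ (p q r s : B) : B :=
  2 • quartic₂ p q r s - quartic₁₁ p q r s - quartic₁₁ p r q s - quartic₁₁ p s q r

theorem cubic₂_right_comm (p q r : B) : cubic₂ p q r = cubic₂ p r q := by
  simp only [cubic₂, mul_comm r q]
  abel

theorem quartic₂_right_comm (p q r s : B) : quartic₂ p q r s = quartic₂ p r q s := by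
  rw [quartic₂, quartic₂, cubic₂_right_comm]
  abel

theorem sum_quartic₁₁ (p q r s : B) :
    quartic₁₁ p r q s + quartic₁₁ p s q r + quartic₁₁ q r p s + quartic₁₁ q s p r =
      4 • ((p * q) * (r * s)) := by
  simp only [quartic₁₁, mul_comm]
  module

namespace IsTortken

variable (hB : IsTortken B)

include hB

theorem quartic₁₁_swap_left (p q r s : B) : quartic₁₁ p q r s = quartic₁₁ q p r s := by
  linear_combination (norm := skip) hB p r q s - hB r p s q
  simp only [quartic₁₁, mul_sub, mul_comm]
  module

theorem quartic₁₁_swap_right (p q r s : B) : quartic₁₁ p q r s = quartic₁₁ p q s r := by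
  linear_combination (norm := skip) hB p r q s - hB r p s q
  simp only [quartic₁₁, mul_sub, mul_comm]
  module

theorem quartic₂_swap_right (p q r s : B) : quartic₂ p q r s = quartic₂ p q s r := by
  linear_combination (norm := skip) hB p r q s + hB r p s q
  simp only [quartic₂, cubic₂, quartic₁₁, mul_add, mul_sub, mul_comm]
  module

theorem quartic₃_right_comm (p q r s : B) : quartic₃ p q r s = quartic₃ p r q s := by
  rw [quartic₃, quartic₃, quartic₂_right_comm, hB.quartic₁₁_swap_right p s q r]
  abel

theorem quartic₃_swap_right (p q r s : B) : quartic₃ p q r s = quartic₃ p q s r := by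
  rw [quartic₃, quartic₃, hB.quartic₂_swap_right, hB.quartic₁₁_swap_right p q r s]
  abel

theorem sum_quartic₂_quartic₁₁ (p q r s : B) :
    quartic₂ r p q s + quartic₂ s p q r + 2 • quartic₁₁ r s p q
      + quartic₁₁ q r p s + quartic₁₁ q s p r = 4 • (p * (q * (r * s))) := by
  linear_combination (norm := skip) 2 • (hB r p s q - hB p q r s - hB q p s r)
  simp only [quartic₂, cubic₂, quartic₁₁, mul_add, mul_sub, mul_comm]
  module

end IsTortken

end TortkenElements

section MonomialMap

open MvPolynomial

variable (R : Type*) {σ α B : Type*} [CommSemiring R] [AddCommMonoid B] [Module R B]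

/-- The linear map that sends the monomial with the multiset of variables `F a` to `v a`, and all
monomials not of this form to `0`. It has this property if `v a` depends on `F a` only. -/
noncomputable def monomialMap (F : α → Multiset σ) (v : α → B) : MvPolynomial σ R →ₗ[R] B :=
  (basisMonomials σ R).constr R fun m => Function.extend F v 0 (Finsupp.toMultiset m)

variable {R}

theorem prod_map_X_eq_monomial [DecidableEq σ] (m : Multiset σ) :
    (m.map X).prod = monomial (R := R) (Multiset.toFinsupp m) 1 := by
  induction m using Multiset.induction_on with
  | empty => simp
  | cons a m ih =>
    rw [Multiset.map_cons, Multiset.prod_cons, ih, ← Multiset.singleton_add, map_add,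
      Multiset.toFinsupp_singleton, X, monomial_mul, one_mul]

theorem monomialMap_prod_map_X (F : α → Multiset σ) (v : α → B) (m : Multiset σ) :
    monomialMap R F v (m.map X).prod = Function.extend F v 0 m := by
  classical
  have prod_eq_basis : (m.map X).prod = basisMonomials σ R (Multiset.toFinsupp m) := by
    rw [prod_map_X_eq_monomial, coe_basisMonomials]
  rw [prod_eq_basis, monomialMap, Module.Basis.constr_basis, Multiset.toFinsupp_toMultiset]

end MonomialMap

/-- The differential monomials at which the map recovering the words of a commutative algebra from
differential polynomials does not vanish: `x_p`, `x_p' x_q`, `x_p'' x_q x_r`, `x_p'' x_q' x_r x_s`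
and `x_p''' x_q x_r x_s`. The orders of the derivatives form the name of each constructor. -/
inductive TestMonomial (σ : Type*)
  | m0 (p : σ)
  | m10 (p q : σ)
  | m200 (p q r : σ)
  | m2100 (p q r s : σ)
  | m3000 (p q r s : σ)

namespace TestMonomial

variable {σ : Type*}

/-- The multiset of variables of a monomial, where `(i, j)` stands for the `j`-th derivative of the
indeterminate `x_i`. -/
def toMultiset : TestMonomial σ → Multiset (σ × ℕ)
  | m0 p => {(p, 0)}
  | m10 p q => {(p, 1), (q, 0)}
  | m200 p q r => {(p, 2), (q, 0), (r, 0)}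
  | m2100 p q r s => {(p, 2), (q, 1), (r, 0), (s, 0)}
  | m3000 p q r s => {(p, 3), (q, 0), (r, 0), (s, 0)}

variable {B : Type v} [NonUnitalNonAssocCommRing B] (b : σ → B)

/-- The orders of the derivatives in a monomial. -/
def orders : TestMonomial σ → Multiset ℕ
  | m0 _ => {0}
  | m10 _ _ => {1, 0}
  | m200 _ _ _ => {2, 0, 0}
  | m2100 _ _ _ _ => {2, 1, 0, 0}
  | m3000 _ _ _ _ => {3, 0, 0, 0}

theorem map_snd_toMultiset (t : TestMonomial σ) : t.toMultiset.map Prod.snd = t.orders := by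
  cases t <;> rfl

/-- The image of a monomial in a commutative algebra with chosen elements `b i`. -/
def value : TestMonomial σ → B
  | m0 p => 8 • b p
  | m10 p q => 4 • (b p * b q)
  | m200 p q r => 4 • cubic₂ (b p) (b q) (b r)
  | m2100 p q r s => quartic₁₁ (b p) (b q) (b r) (b s)
  | m3000 p q r s => quartic₃ (b p) (b q) (b r) (b s)

theorem value_eq_of_toMultiset_eq {t t' : TestMonomial σ} (h : t.toMultiset = t'.toMultiset)
    (hB : t.toMultiset.card = 4 → IsTortken B) : t.value b = t'.value b := by
  have orders_eq : t.orders = t'.orders := by rw [← map_snd_toMultiset, h, map_snd_toMultiset]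
  have derivatives_eq (n : ℕ) := congrArg (fun m => (m.filter (·.2 = n)).map Prod.fst) h
  cases t <;> cases t' <;>
    first
    | exact absurd orders_eq (of_decide_eq_true rfl)
    | skip
  case m0.m0 p p' =>
    obtain rfl : p = p' := by simpa [toMultiset] using h
    rfl
  case m10.m10 p q p' q' =>
    obtain rfl : q = q' := by simpa [toMultiset, Multiset.filter_singleton] using derivatives_eq 0
    obtain rfl : p = p' := by simpa [toMultiset, Multiset.filter_singleton] using derivatives_eq 1
    rfl
  case m200.m200 p q r p' q' r' =>
    have level₀ : ({q, r} : Multiset σ) = {q', r'} := by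
      simpa [toMultiset, Multiset.filter_singleton] using derivatives_eq 0
    obtain rfl : p = p' := by simpa [toMultiset, Multiset.filter_singleton] using derivatives_eq 2
    exact eq_of_pair_eq (F := fun q r => 4 • cubic₂ (b p) (b q) (b r))
      (fun q r => by rw [cubic₂_right_comm]) level₀
  case m2100.m2100 p q r s p' q' r' s' =>
    have level₀ : ({r, s} : Multiset σ) = {r', s'} := by
      simpa [toMultiset, Multiset.filter_singleton] using derivatives_eq 0
    obtain rfl : q = q' := by simpa [toMultiset, Multiset.filter_singleton] using derivatives_eq 1
    obtain rfl : p = p' := by simpa [toMultiset, Multiset.filter_singleton] using derivatives_eq 2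
    exact eq_of_pair_eq (F := fun r s => quartic₁₁ (b p) (b q) (b r) (b s))
      (fun r s => (hB rfl).quartic₁₁_swap_right _ _ _ _) level₀
  case m3000.m3000 p q r s p' q' r' s' =>
    have level₀ : ({q, r, s} : Multiset σ) = {q', r', s'} := by
      simpa [toMultiset, Multiset.filter_singleton] using derivatives_eq 0
    obtain rfl : p = p' := by simpa [toMultiset, Multiset.filter_singleton] using derivatives_eq 3
    exact eq_of_triple_eq (F := fun q r s => quartic₃ (b p) (b q) (b r) (b s))
      (fun q r s => (hB rfl).quartic₃_right_comm _ _ _ _)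
      (fun q r s => (hB rfl).quartic₃_swap_right _ _ _ _) level₀

end TestMonomial

section DifferentialPolynomials

open MvPolynomial

variable {R σ : Type*} [CommRing R]

variable (R σ) in
/-- The derivation of the algebra of differential polynomials in indeterminates `x_i`, where the
variable `X (i, j)` is the `j`-th derivative of `x_i`. -/
noncomputable def totalDeriv : Derivation R (MvPolynomial (σ × ℕ) R) (MvPolynomial (σ × ℕ) R) :=
  mkDerivation R fun i => X (i.1, i.2 + 1)

theorem totalDeriv_X (i : σ) (j : ℕ) : totalDeriv R σ (X (i, j)) = X (i, j + 1) :=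
  mkDerivation_X _ _ _

theorem totalDeriv_mul (f g : MvPolynomial (σ × ℕ) R) :
    totalDeriv R σ (f * g) = totalDeriv R σ f * g + f * totalDeriv R σ g := by
  rw [Derivation.leibniz, smul_eq_mul, smul_eq_mul, mul_comm g, add_comm]

variable {B : Type v} [NonUnitalNonAssocCommRing B] [Module R B] (b : σ → B)

variable (R) in
/-- A linear map that carries the value of a word of length at most `4` in differential polynomials,
with the product `(f g)'`, to `8` times its value in `B`. -/
noncomputable def recover : MvPolynomial (σ × ℕ) R →ₗ[R] B :=
  monomialMap R TestMonomial.toMultiset (TestMonomial.value b)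

theorem recover_prod_toMultiset (t : TestMonomial σ)
    (hB : t.toMultiset.card = 4 → IsTortken B) :
    recover R b (t.toMultiset.map X).prod = t.value b := by
  classical
  rw [recover, monomialMap_prod_map_X, Function.extend_def, dif_pos ⟨t, rfl⟩]
  generalize_proofs h
  exact (TestMonomial.value_eq_of_toMultiset_eq b h.choose_spec.symm hB).symm

theorem recover_X (p : σ) : recover R b (X (p, 0)) = 8 • b p := by
  simpa [TestMonomial.toMultiset, TestMonomial.value] using
    recover_prod_toMultiset (R := R) b (.m0 p) fun h => by simp [TestMonomial.toMultiset] at h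

theorem recover_X10 (p q : σ) : recover R b (X (p, 1) * X (q, 0)) = 4 • (b p * b q) := by
  simpa [TestMonomial.toMultiset, TestMonomial.value] using
    recover_prod_toMultiset (R := R) b (.m10 p q) fun h => by simp [TestMonomial.toMultiset] at h

theorem recover_X200 (p q r : σ) :
    recover R b (X (p, 2) * X (q, 0) * X (r, 0)) = 4 • cubic₂ (b p) (b q) (b r) := by
  simpa [TestMonomial.toMultiset, TestMonomial.value, mul_assoc] using
    recover_prod_toMultiset (R := R) b (.m200 p q r) fun h => by simp [TestMonomial.toMultiset] at h

theorem recover_X2100 (hB : IsTortken B) (p q r s : σ) :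
    recover R b (X (p, 2) * X (q, 1) * X (r, 0) * X (s, 0)) =
      quartic₁₁ (b p) (b q) (b r) (b s) := by
  simpa [TestMonomial.toMultiset, TestMonomial.value, mul_assoc] using
    recover_prod_toMultiset (R := R) b (.m2100 p q r s) fun _ => hB

theorem recover_X3000 (hB : IsTortken B) (p q r s : σ) :
    recover R b (X (p, 3) * X (q, 0) * X (r, 0) * X (s, 0)) =
      quartic₃ (b p) (b q) (b r) (b s) := by
  simpa [TestMonomial.toMultiset, TestMonomial.value, mul_assoc] using
    recover_prod_toMultiset (R := R) b (.m3000 p q r s) fun _ => hB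

theorem recover_prod_eq_zero {m : Multiset (σ × ℕ)}
    (hm : ∀ t : TestMonomial σ, t.orders ≠ m.map Prod.snd) :
    recover R b (m.map X).prod = 0 := by
  rw [recover, monomialMap_prod_map_X]
  refine Function.extend_apply' _ _ _ fun ⟨t, ht⟩ => hm t ?_
  rw [← ht, TestMonomial.map_snd_toMultiset]

theorem recover_X110 (p q r : σ) : recover R b (X (p, 1) * X (q, 1) * X (r, 0)) = 0 := by
  simpa [mul_assoc] using recover_prod_eq_zero (R := R) b
    (m := {(p, 1), (q, 1), (r, 0)}) fun t => by cases t <;> exact of_decide_eq_true rfl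

theorem recover_X1110 (p q r s : σ) :
    recover R b (X (p, 1) * X (q, 1) * X (r, 1) * X (s, 0)) = 0 := by
  simpa [mul_assoc] using recover_prod_eq_zero (R := R) b
    (m := {(p, 1), (q, 1), (r, 1), (s, 0)}) fun t => by cases t <;> exact of_decide_eq_true rfl

theorem recover_totalDeriv_X200 (hB : IsTortken B) (p q r s : σ) :
    recover R b (totalDeriv R σ (X (p, 2) * X (q, 0) * X (r, 0) * X (s, 0))) =
      2 • quartic₂ (b p) (b q) (b r) (b s) := by
  have leibniz : totalDeriv R σ (X (p, 2) * X (q, 0) * X (r, 0) * X (s, 0)) =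
      X (p, 3) * X (q, 0) * X (r, 0) * X (s, 0) + X (p, 2) * X (q, 1) * X (r, 0) * X (s, 0)
        + X (p, 2) * X (r, 1) * X (q, 0) * X (s, 0)
        + X (p, 2) * X (s, 1) * X (q, 0) * X (r, 0) := by
    simp only [totalDeriv_mul, totalDeriv_X]
    ring
  simp only [leibniz, map_add, recover_X2100 b hB, recover_X3000 b hB, quartic₃]
  abel

theorem recover_totalDeriv_X1100 (hB : IsTortken B) (p q r s : σ) :
    recover R b (totalDeriv R σ (X (p, 1) * X (q, 1) * X (r, 0) * X (s, 0))) =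
      2 • quartic₁₁ (b p) (b q) (b r) (b s) := by
  have leibniz : totalDeriv R σ (X (p, 1) * X (q, 1) * X (r, 0) * X (s, 0)) =
      X (p, 2) * X (q, 1) * X (r, 0) * X (s, 0) + X (q, 2) * X (p, 1) * X (r, 0) * X (s, 0)
        + X (p, 1) * X (q, 1) * X (r, 1) * X (s, 0)
        + X (p, 1) * X (q, 1) * X (s, 1) * X (r, 0) := by
    simp only [totalDeriv_mul, totalDeriv_X]
    ring
  simp only [leibniz, map_add, recover_X2100 b hB, recover_X1110,
    hB.quartic₁₁_swap_left (b q) (b p)]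
  abel

theorem recover_mul (i j : σ) :
    recover R b (totalDeriv R σ (X (i, 0) * X (j, 0))) = 8 • (b i * b j) := by
  rw [totalDeriv_mul, totalDeriv_X, totalDeriv_X, mul_comm (X (i, 0)), map_add, recover_X10,
    recover_X10, mul_comm (b j), ← add_nsmul]

theorem recover_mul_mul (i j k : σ) :
    recover R b (totalDeriv R σ (X (i, 0) * totalDeriv R σ (X (j, 0) * X (k, 0)))) =
      8 • (b i * (b j * b k)) := by
  have leibniz : totalDeriv R σ (X (i, 0) * totalDeriv R σ (X (j, 0) * X (k, 0))) =
      X (i, 1) * X (j, 1) * X (k, 0) + X (i, 1) * X (k, 1) * X (j, 0)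
        + X (j, 2) * X (i, 0) * X (k, 0) + X (k, 2) * X (i, 0) * X (j, 0)
        + (X (j, 1) * X (k, 1) * X (i, 0) + X (j, 1) * X (k, 1) * X (i, 0)) := by
    simp only [totalDeriv_mul, totalDeriv_X, map_add]
    ring
  simp only [leibniz, map_add, recover_X110, recover_X200]
  simp only [cubic₂, mul_comm]
  module

theorem recover_mul_mul_mul (hB : IsTortken B) (i j k l : σ) :
    recover R b (totalDeriv R σ (X (i, 0) *
      totalDeriv R σ (X (j, 0) * totalDeriv R σ (X (k, 0) * X (l, 0))))) =
      8 • (b i * (b j * (b k * b l))) := by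
  have leibniz : X (i, 0) * totalDeriv R σ (X (j, 0) * totalDeriv R σ (X (k, 0) * X (l, 0))) =
      X (k, 2) * X (i, 0) * X (j, 0) * X (l, 0) + X (l, 2) * X (i, 0) * X (j, 0) * X (k, 0)
        + X (j, 1) * X (k, 1) * X (i, 0) * X (l, 0) + X (j, 1) * X (l, 1) * X (i, 0) * X (k, 0)
        + (X (k, 1) * X (l, 1) * X (i, 0) * X (j, 0)
          + X (k, 1) * X (l, 1) * X (i, 0) * X (j, 0)) := by
    simp only [totalDeriv_mul, totalDeriv_X, map_add]
    ring
  simp only [leibniz, map_add, recover_totalDeriv_X1100 b hB, recover_totalDeriv_X200 b hB]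
  linear_combination (norm := module)
    2 • hB.sum_quartic₂_quartic₁₁ (b i) (b j) (b k) (b l)

theorem recover_mul_mul_mul_mul (hB : IsTortken B) (i j k l : σ) :
    recover R b (totalDeriv R σ
      (totalDeriv R σ (X (i, 0) * X (j, 0)) * totalDeriv R σ (X (k, 0) * X (l, 0)))) =
      8 • ((b i * b j) * (b k * b l)) := by
  have leibniz : totalDeriv R σ (X (i, 0) * X (j, 0)) * totalDeriv R σ (X (k, 0) * X (l, 0)) =
      X (i, 1) * X (k, 1) * X (j, 0) * X (l, 0) + X (i, 1) * X (l, 1) * X (j, 0) * X (k, 0)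
        + X (j, 1) * X (k, 1) * X (i, 0) * X (l, 0)
        + X (j, 1) * X (l, 1) * X (i, 0) * X (k, 0) := by
    simp only [totalDeriv_mul, totalDeriv_X]
    ring
  simp only [leibniz, map_add, recover_totalDeriv_X1100 b hB]
  linear_combination (norm := module) 2 • sum_quartic₁₁ (b i) (b j) (b k) (b l)

end DifferentialPolynomials

section NovikovJordanIdentities

open MvPolynomial GelfandDorfman

variable {K : Type u} [Field K]

theorem recover_lift {σ : Type*} {B : Type v} [NonUnitalNonAssocCommRing B] [Module K B]
    (b : σ → B) {w : FreeMagma σ} (hw : w.length ≤ 4) (hB : w.length = 4 → IsTortken B) :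
    recover K b ((toPlus (totalDeriv K σ)).symm
      (FreeMagma.lift (fun i => toPlus (totalDeriv K σ) (X (i, 0))) w)) =
        8 • FreeMagma.lift b w := by
  let x (i : σ) : PlusAlg (GelfandDorfman (totalDeriv K σ)) := toPlus _ (X (i, 0))
  have lift_pair := lift_prodMk x b w
  have length_pos := w.length_pos
  obtain h | h | h | h :
    w.length = 1 ∨ w.length = 2 ∨ w.length = 3 ∨ w.length = 4 := by omega
  · obtain ⟨i, hi⟩ := exists_lift_eq_of_length_eq_one (fun i => (x i, b i)) h
    obtain ⟨hx, hb⟩ := Prod.mk.inj (lift_pair.symm.trans hi)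
    rw [hx, hb, LinearEquiv.symm_apply_apply, recover_X]
  · obtain ⟨i, j, hij⟩ := exists_lift_eq_of_length_eq_two (fun i => (x i, b i)) h
    simp only [lift_pair, Prod.mk_mul_mk, Prod.mk.injEq, x, toPlus_mul_toPlus] at hij
    rw [hij.1, hij.2, LinearEquiv.symm_apply_apply, recover_mul]
  · obtain ⟨i, j, k, hijk⟩ := exists_lift_eq_of_length_eq_three (fun i => (x i, b i)) h
    simp only [lift_pair, Prod.mk_mul_mk, Prod.mk.injEq, x, toPlus_mul_toPlus] at hijk
    rw [hijk.1, hijk.2, LinearEquiv.symm_apply_apply, recover_mul_mul]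
  · obtain ⟨i, j, k, l, hijkl | hijkl⟩ :=
      exists_lift_eq_of_length_eq_four (fun i => (x i, b i)) h <;>
    simp only [lift_pair, Prod.mk_mul_mk, Prod.mk.injEq, x, toPlus_mul_toPlus] at hijkl <;>
    rw [hijkl.1, hijkl.2, LinearEquiv.symm_apply_apply]
    · exact recover_mul_mul_mul b (hB h) i j k l
    · exact recover_mul_mul_mul_mul b (hB h) i j k l

theorem IsNovikovJordanIdentity.isIdentityOn (h2 : (2 : K) ≠ 0) {f : NAPoly K}
    (hf : IsNovikovJordanIdentity K f) {B : Type v} [NonUnitalNonAssocCommRing B] [Module K B]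
    [IsScalarTower K B B] [SMulCommClass K B B]
    (hB : DegreeLE 3 f ∨ DegreeLE 4 f ∧ IsTortken B) : IsIdentityOn K f B := by
  intro b
  let D := totalDeriv K ℕ
  have recover_word (w : FreeMagma ℕ) (hw : w ∈ f.coeff.support) :
      (recover K b ∘ₗ (toPlus D).symm.toLinearMap)
        (FreeMagma.lift (fun i => toPlus D (X (i, 0))) w) = (8 : K) • FreeMagma.lift b w := by
    rw [ofNat_smul_eq_nsmul]
    obtain hdeg | ⟨hdeg, hB⟩ := hB
    · have := hdeg w hw
      exact recover_lift b (by omega) (by omega)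
    · exact recover_lift b (hdeg w hw) fun _ => hB
  have eight_smul_eq_zero := map_lift_eq_smul_lift _ _ _ _ recover_word
  rw [hf _ (isNovikov D), map_zero] at eight_smul_eq_zero
  have h8 : (8 : K) ≠ 0 := by
    rw [show (8 : K) = 2 ^ 3 by norm_num]
    exact pow_ne_zero 3 h2
  exact (smul_eq_zero_iff_right h8).1 eight_smul_eq_zero.symm

theorem card_letters (w : FreeMagma ℕ) : (letters w).card = w.length := by
  induction w with
  | ih1 i => rfl
  | ih2 u v hu hv => exact (Multiset.card_add _ _).trans (congrArg₂ (· + ·) hu hv)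

theorem IsMultilinearPoly.degreeLE {n : ℕ} {f : NAPoly K} (hf : IsMultilinearPoly n f) :
    DegreeLE n f := fun w hw => by
  rw [← card_letters, hf w hw, Multiset.card_range]

theorem mainTheorem1_general (K : Type u) [Field K] :
    (∀ (A : Type v) [NonUnitalNonAssocRing A], IsNovikov A → IsTortken (PlusAlg A)) ∧
    ¬ FollowsFrom K {comPoly K} (tortkenPoly K) ∧
    (ringChar K ≠ 2 →
      (∀ f : NAPoly K, DegreeLE 3 f →
        (IsNovikovJordanIdentity K f ↔ FollowsFrom K {comPoly K} f)) ∧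
      (∀ f : NAPoly K, DegreeLE 4 f →
        (IsNovikovJordanIdentity K f ↔ FollowsFrom K {comPoly K, tortkenPoly K} f))) := by
  refine ⟨fun A _ => PlusAlg.isTortken, not_followsFrom_comPoly_tortkenPoly, fun hchar => ?_⟩
  have h2 : (2 : K) ≠ 0 := Ring.two_ne_zero hchar
  refine ⟨fun f hdeg => ⟨fun hf => ?_, fun hf => hf.isNovikovJordanIdentity (by simp)⟩,
    fun f hdeg => ⟨fun hf => ?_, fun hf => hf.isNovikovJordanIdentity (by simp)⟩⟩
  · exact (followsFrom_iff_of_comPoly_mem (Set.mem_singleton _)).2 fun B _ _ _ _ _ =>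
      hf.isIdentityOn h2 (.inl hdeg)
  · refine (followsFrom_iff_of_comPoly_mem (.inl rfl)).2 fun B _ _ _ _ hB => ?_
    exact hf.isIdentityOn h2 (.inr ⟨hdeg, (isIdentityOn_tortkenPoly_iff B).1 (hB _ (.inr rfl))⟩)

end NovikovJordanIdentities

theorem mainTheorem1 (K : Type u) [Field K] :
    -- for every Novikov algebra `A` over `K`, the algebra `A⁺` is Tortken
    (∀ (A : Type v) [NonUnitalNonAssocRing A] [Module K A] [IsScalarTower K A A]
      [SMulCommClass K A A], IsNovikov A → IsTortken (PlusAlg A)) ∧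
    -- in characteristic `≠ 2` the Tortken identity is the Jordan identity of the class
    (ringChar K ≠ 2 →
      -- it does not follow from commutativity
      ¬ FollowsFrom K {comPoly K} (tortkenPoly K) ∧
      -- identities of degree at most `3` are the consequences of commutativity
      (∀ f : NAPoly K, DegreeLE 3 f →
        (IsNovikovJordanIdentity K f ↔ FollowsFrom K {comPoly K} f)) ∧
      -- multilinear identities of degree `4` are the consequences of commutativity and Tortken
      (∀ f : NAPoly K, IsMultilinearPoly 4 f →
        (IsNovikovJordanIdentity K f ↔ FollowsFrom K {comPoly K, tortkenPoly K} f))) := by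
  obtain ⟨isTortken, not_followsFrom, iff⟩ := mainTheorem1_general.{u, v} K
  exact ⟨fun A _ _ _ _ => isTortken A, fun hchar => ⟨not_followsFrom, (iff hchar).1,
    fun f hf => (iff hchar).2 f hf.degreeLE⟩⟩
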